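/- Write $q=e^{2\pi i\tau}$, and $q^{r}=e^{2\pi i r\tau}$ for real $r$. Let $m,s$ be integers with $0\le s\le m$. For $\operatorname{Im}\tau>0$, $j\in\mathbb Z$ and $z,v\in\mathbb C$ put $$\Theta_{j,m+1}(\tau,z)=\sum_{n\in\mathbb Z}e^{2\pi i(m+1)z\left(n+\frac{j}{2(m+1)}\right)}q^{(m+1)\left(n+\frac{j}{2(m+1)}\right)^2},\qquad E(x)=2\int_0^x e^{-\pi u^2}\,du,$$ $$R_{j;m+1}(\tau,v)=\sum_{\substack{n\in\mathbb Z\\ n\equiv -j\bmod 2(m+1)}}\Bigl(\operatorname{sgn}\bigl(n+\tfrac12+j-2(m+1)\bigr)-E\Bigl(\bigl(n+2(m+1)\tfrac{\operatorname{Im}v}{\operatorname{Im}\tau}\bigr)\sqrt{\tfrac{\operatorname{Im}\tau}{m+1}}\Bigr)\Bigr)e^{-\frac{\pi i n^2}{2(m+1)}\tau-2\pi i nv}.$$ For $t\in\mathbb C$ and $z_1,z_2\in\mathbb C\setminus(\mathbb Z+\mathbb Z\tau)$ put $$\Phi_1^{[m;s]}(\tau,z_1,z_2)=\sum_{j\in\mathbb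 Z}\frac{e^{2\pi i(m+1)j(z_1+z_2)}e^{-2\pi i s z_1}q^{j^2(m+1)-js}}{1-e^{2\pi i z_1}q^j},$$ $$\Phi^{[m;s]}(\tau,z_1,z_2,t)=e^{2\pi i(m+1)t}\bigl(\Phi_1^{[m;s]}(\tau,z_1,z_2)-\Phi_1^{[m;s]}(\tau,-z_2,-z_1)\bigr),$$ $$\widetilde\Phi^{[m;s]}(\tau,z_1,z_2,t)=\Phi^{[m;s]}(\tau,z_1,z_2,t)+\tfrac12e^{2\pi i(m+1)t}\sum_{j=-s}^{-s+2m+1}R_{j;m+1}\Bigl(\tau,\frac{z_1-z_2}{2}\Bigr)\bigl(\Theta_{j,m+1}-\Theta_{-j,m+1}\bigr)(\tau,z_1+z_2).$$ **Theorem 2.2.** Let $M$ be a positive integer and let $m,s$ be integers with $0\le s\le m$, such that $\gcd(M,2m+2)=1$ if $m>0$. Let $\operatorname{Im}\tau>0$, $t\in\mathbb C$ and $z_1,z_2\in\mathbb C\setminus(\mathbb Z+\mathbb Z\tau)$. Then, for $j,k\in\mathbb Z$, the quantity $$q^{\frac{m+1}{M}jk}\,e^{\frac{2\pi i(m+1)}{M}(kz_1+jz_2)}\,\widetilde\Phi^{[m;s]}(M\tau,z_1+j\tau,z_2+k\tau,t)$$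 depends only on $j,k\bmod M$, and $$\widetilde\Phi^{[m;s]}\Bigl(-\frac M\tau,\frac{z_1}\tau,\frac{z_2}\tau,t-\frac{z_1z_2}{\tau M}\Bigr)=\frac{\tau}{M}\sum_{j,k\in\mathbb Z/M\mathbb Z}q^{\frac{m+1}{M}jk}\,e^{\frac{2\pi i(m+1)}{M}(kz_1+jz_2)}\,\widetilde\Phi^{[m;s]}(M\tau,z_1+j\tau,z_2+k\tau,t).$$ -/

import Mathlib

namespace MockTheta

noncomputable section

open Complex

/-- `e x = exp (2 π i x)`. With `q = e τ`, a power `q ^ r` is written `e (r * τ)`. -/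
def e (x : ℂ) : ℂ := Complex.exp (2 * (Real.pi : ℂ) * I * x)

/-- The theta function of degree `d`,
`Θ_{j,d}(τ, z) = ∑_{n ∈ ℤ} e^{2πi d z (n + j/2d)} q^{d (n + j/2d)^2}`. -/
def Theta (j : ℤ) (d : ℕ) (τ z : ℂ) : ℂ :=
  ∑' n : ℤ, e (d * z * (n + j / (2 * d))) * e (d * (n + j / (2 * d)) ^ 2 * τ)

/-- `Φ₁^{[m;s]}(τ, z₁, z₂)`, the sum over `j ∈ ℤ` of
`e^{2πi(m+1)j(z₁+z₂)} e^{-2πi s z₁} q^{j²(m+1) - js} / (1 - e^{2πi z₁} q^j)`. -/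
def PhiOne (m s : ℕ) (τ z₁ z₂ : ℂ) : ℂ :=
  ∑' j : ℤ, e ((m + 1) * j * (z₁ + z₂)) * e (-(s * z₁)) *
    e (((j : ℂ) ^ 2 * (m + 1) - j * s) * τ) / (1 - e z₁ * e (j * τ))

/-- The mock theta function
`Φ^{[m;s]}(τ, z₁, z₂, t) = e^{2πi(m+1)t} (Φ₁(τ, z₁, z₂) - Φ₁(τ, -z₂, -z₁))`. -/
def Phi (m s : ℕ) (τ z₁ z₂ t : ℂ) : ℂ :=
  e ((m + 1) * t) * (PhiOne m s τ z₁ z₂ - PhiOne m s τ (-z₂) (-z₁))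

/-- `E(x) = 2 ∫₀ˣ e^{-π u²} du`. -/
def E (x : ℝ) : ℝ := 2 * ∫ u in (0 : ℝ)..x, Real.exp (-Real.pi * u ^ 2)

/-- The modified Zwegers function `R_{j;d}(τ, v)`, the sum over integers `n ≡ -j mod 2d` of
`(sgn(n + 1/2 + j - 2d) - E((n + 2d Im v / Im τ) √(Im τ / d))) e^{-πi n² τ / (2d) - 2πi n v}`. -/
def R (j : ℤ) (d : ℕ) (τ v : ℂ) : ℂ :=
  ∑' n : {n : ℤ // n ≡ -j [ZMOD 2 * d]},
    ((Real.sign ((n : ℤ) + 1 / 2 + j - 2 * d)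
        - E (((n : ℤ) + 2 * d * (v.im / τ.im)) * Real.sqrt (τ.im / d)) : ℝ) : ℂ) *
      Complex.exp (-((Real.pi : ℂ) * I * ((n : ℤ) : ℂ) ^ 2 / (2 * d)) * τ
        - 2 * (Real.pi : ℂ) * I * ((n : ℤ) : ℂ) * v)

/-- The real analytic correction `Φ_add^{[m;s]}(τ, z₁, z₂, t)`. -/
def PhiAdd (m s : ℕ) (τ z₁ z₂ t : ℂ) : ℂ :=
  1 / 2 * e ((m + 1) * t) *
    ∑ j ∈ Finset.Icc (-(s : ℤ)) (-(s : ℤ) + 2 * m + 1),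
      R j (m + 1) τ ((z₁ - z₂) / 2) *
        (Theta j (m + 1) τ (z₁ + z₂) - Theta (-j) (m + 1) τ (z₁ + z₂))

/-- The modified function `Φ~^{[m;s]} = Φ^{[m;s]} + Φ_add^{[m;s]}`. -/
def PhiTilde (m s : ℕ) (τ z₁ z₂ t : ℂ) : ℂ :=
  Phi m s τ z₁ z₂ t + PhiAdd m s τ z₁ z₂ t

/-- The function
`q^{(m+1)jk/M} e^{2πi(m+1)(k z₁ + j z₂)/M} Φ~^{[m;s]}(Mτ, z₁ + jτ, z₂ + kτ, t)`. -/
def shiftedPhiTilde (M m s : ℕ) (j k : ℤ) (τ z₁ z₂ t : ℂ) : ℂ :=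
  e ((m + 1) / M * j * k * τ) * e ((m + 1) / M * (k * z₁ + j * z₂)) *
    PhiTilde m s (M * τ) (z₁ + j * τ) (z₂ + k * τ) t

end

end MockTheta

/-!
The proof rests on a closed form for the completed Appell function
`A(τ, z₁, z₂) = Φ₁(τ, z₁, z₂) + ½ ∑ⱼ Rⱼ(τ, (z₁ - z₂)/2) Θⱼ(τ, z₁ + z₂)`: with `d = m + 1`,
`y = Im τ` and `λ = aτ + n`, it equals the absolutely convergent lattice sum
`-(1/2πi) ∑_{a,n} e(d a z₂) exp(-(πd/y) (z₁ + λ)(conj (z₁ + λ) + z₂ - conj z₂)) / (z₁ + λ)`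
(`latticeAppell`, `PhiOne_add_eq_latticeAppell`). In particular it does not depend on `s`.

For the closed form, `Φ₁` and, after regrouping the double series, `∑ RⱼΘⱼ` are written as sums over
`a`, and the identity is proved for each `a` separately (`appellRow_eq`), as an identity between
functions of `w = z₁ + aτ` and a real parameter `b = d Im z₂ / y`. Differentiating in `b` removes
the denominators `w + n` on one side and turns `E` into a Gaussian on the other; the two
derivatives agree by Poisson summation (`tsum_gaussRow`). Hence the difference of the two sides
is constant in `b`. But both sides are multiplied by `e(-w) ≠ 1` under `b ↦ b + 1`, so this
constant is zero. This treats real and non-real `w` alike.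

Since the lattice sum is odd, `Φ~ = e(dt) (A(z₁, z₂) + A(z₂, z₁))` (`PhiTilde_eq`), and everything
else is reindexing of lattice sums. The inversion `τ ↦ -M/τ` turns `A` into `τ` times a sum over
the lattice `ℤτ + Mℤ` (`latticeAppell_inversion`). On the other side, the sum over `j` of the
sums over `ℤMτ + ℤ`, shifted by `jτ`, runs over `ℤτ + ℤ`, and the sum over `k` of the phases
`e(-dkn/M)` is `M` if `M ∣ n` and `0` otherwise because `gcd(M, d) = 1`, which leaves
`ℤτ + Mℤ` again (`sum_shiftedLattice`).
-/

namespace MockTheta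

noncomputable section

open Complex Filter Topology ComplexConjugate

/-! ### The exponential, Gaussian sums and the error function -/

lemma e_add (x y : ℂ) : e (x + y) = e x * e y := by
  simp only [e, ← Complex.exp_add]; congr 1; ring

lemma e_zero : e 0 = 1 := by simp [e]

lemma e_ne_zero (x : ℂ) : e x ≠ 0 := Complex.exp_ne_zero _

lemma e_int (n : ℤ) : e n = 1 := by
  rw [e, Complex.exp_eq_one_iff]; exact ⟨n, by ring⟩

lemma e_add_int (x : ℂ) (n : ℤ) : e (x + n) = e x := by rw [e_add, e_int, mul_one]

lemma e_eq_one_iff {x : ℂ} : e x = 1 ↔ ∃ n : ℤ, x = n := by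
  rw [e, Complex.exp_eq_one_iff]
  have : (2 * (Real.pi : ℂ) * I) ≠ 0 := Complex.two_pi_I_ne_zero
  constructor
  · rintro ⟨n, hn⟩
    exact ⟨n, mul_left_cancel₀ this (by rw [hn]; ring)⟩
  · rintro ⟨n, rfl⟩
    exact ⟨n, by ring⟩

lemma norm_e (x : ℂ) : ‖e x‖ = Real.exp (-(2 * Real.pi * x.im)) := by
  rw [e, Complex.norm_exp]; congr 1; simp

lemma summable_gaussian {A : ℝ} (hA : 0 < A) (B c : ℝ) :
    Summable fun n : ℤ => Real.exp (-A * (n + c) ^ 2 + B * n) := by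
  have h := (summable_jacobiTheta₂_term_iff (((B - 2 * A * c : ℝ) : ℂ) / (2 * Real.pi * I))
    (I * (A / Real.pi : ℝ))).2 (by
      simp only [mul_im, I_re, I_im, ofReal_im, ofReal_re]
      have := div_pos hA Real.pi_pos
      linarith)
  refine (h.norm.mul_left (Real.exp (-A * c ^ 2))).congr fun n => ?_
  have hpi : (Real.pi : ℂ) ≠ 0 := by exact_mod_cast Real.pi_ne_zero
  have : 2 * (Real.pi : ℂ) * I * n * (((B - 2 * A * c : ℝ) : ℂ) / (2 * Real.pi * I))
      + Real.pi * I * n ^ 2 * (I * (A / Real.pi : ℝ))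
      = (((B - 2 * A * c) * n - A * n ^ 2 : ℝ) : ℂ) := by
    push_cast
    field_simp
    rw [I_sq]; ring
  rw [jacobiTheta₂_term, this, Complex.norm_exp, ofReal_re, ← Real.exp_add]
  congr 1; ring

lemma hasDerivAt_E (x : ℝ) : HasDerivAt E (2 * Real.exp (-Real.pi * x ^ 2)) x := by
  have hc : Continuous fun u : ℝ => Real.exp (-Real.pi * u ^ 2) := by fun_prop
  exact (intervalIntegral.integral_hasDerivAt_right (hc.intervalIntegrable _ _)
    hc.aestronglyMeasurable.stronglyMeasurableAtFilter hc.continuousAt).const_mul 2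

lemma E_neg (x : ℝ) : E (-x) = -E x := by
  have h := intervalIntegral.integral_comp_neg (a := 0) (b := x)
    (fun u : ℝ => Real.exp (-Real.pi * u ^ 2))
  simp only [neg_sq, neg_zero] at h
  rw [E, E, h, intervalIntegral.integral_symm (-x) 0]
  ring

/-- For `u ≥ x ≥ 0`, `exp (-πu²) ≤ exp (-πx²) exp (-π(u - x)²)`. -/
lemma abs_one_sub_E_le {x : ℝ} (hx : 0 ≤ x) : |1 - E x| ≤ Real.exp (-Real.pi * x ^ 2) := by
  set f : ℝ → ℝ := fun u => Real.exp (-Real.pi * u ^ 2) with hf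
  have hfi : MeasureTheory.Integrable f := integrable_exp_neg_mul_sq Real.pi_pos
  have h1 : ∫ u in Set.Ioi (0 : ℝ), f u = 1 / 2 := by
    rw [hf, integral_gaussian_Ioi, div_self Real.pi_ne_zero, Real.sqrt_one]
  have h2 : 1 - E x = 2 * ∫ u in Set.Ioi x, f u := by
    have := intervalIntegral.integral_Ioi_sub_Ioi (f := f) (hfi.integrableOn) hx
    rw [E, ← hf, ← this, h1]; ring
  have h3 : ∫ u in Set.Ioi x, f u ≤ f x * ∫ u in Set.Ioi (0 : ℝ), f u := by
    have h4 : ∫ u in Set.Ioi x, f (u - x) = ∫ u in Set.Ioi (0 : ℝ), f u := by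
      have := (MeasureTheory.measurePreserving_sub_right MeasureTheory.volume
        x).setIntegral_preimage_emb
        (MeasurableEquiv.subRight x).measurableEmbedding f (Set.Ioi 0)
      simpa using this
    rw [← h4, ← MeasureTheory.integral_const_mul]
    refine MeasureTheory.setIntegral_mono_on hfi.integrableOn
      ((hfi.comp_sub_right x).const_mul _).integrableOn measurableSet_Ioi fun u hu => ?_
    simp only [hf, ← Real.exp_add]
    refine Real.exp_le_exp.2 ?_
    have : 0 ≤ Real.pi * (x * (u - x)) :=
      mul_nonneg Real.pi_pos.le (mul_nonneg hx (sub_nonneg.2 (le_of_lt hu)))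
    nlinarith
  have h0 : 0 ≤ ∫ u in Set.Ioi x, f u := MeasureTheory.integral_nonneg fun u => (Real.exp_pos _).le
  rw [h2, abs_of_nonneg (by linarith)]
  rw [h1] at h3
  linarith

/-- The sign of `k - σ - 1/2`. It is independent of the representative `j` chosen in `R`, and
`σ` can be moved freely at the cost of finitely many terms. -/
def signStep (σ k : ℤ) : ℝ := if σ < k then 1 else -1

lemma eventually_abs_signStep_sub_E_le (σ : ℤ) (c : ℝ) {r : ℝ} (hr : 0 < r) :
    ∀ᶠ k : ℤ in cofinite,
      |signStep σ k - E ((k + c) * r)| ≤ Real.exp (-Real.pi * ((k + c) * r) ^ 2) := by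
  rw [Int.cofinite_eq, eventually_sup]
  constructor
  · filter_upwards [eventually_le_atBot σ, eventually_le_atBot ⌊-c⌋] with k h1 h2
    have h3 : (k : ℝ) ≤ -c := (Int.cast_le.2 h2).trans (Int.floor_le _)
    have h4 : (k + c) * r ≤ 0 := mul_nonpos_of_nonpos_of_nonneg (by linarith) hr.le
    have := abs_one_sub_E_le (neg_nonneg.2 h4)
    rw [E_neg, neg_sq, abs_sub_comm] at this
    rw [signStep, if_neg (not_lt.2 h1)]
    convert this using 2; ring
  · filter_upwards [eventually_gt_atTop σ, eventually_ge_atTop ⌈-c⌉] with k h1 h2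
    have h3 : -c ≤ (k : ℝ) := (Int.le_ceil _).trans (Int.cast_le.2 h2)
    rw [signStep, if_pos h1]
    exact abs_one_sub_E_le (mul_nonneg (by linarith) hr.le)

/-! ### The identity for a single row of the lattice -/

lemma hasDerivAt_e_const_mul (c : ℂ) (b : ℝ) :
    HasDerivAt (fun b : ℝ => e (-(b * c))) (-(2 * Real.pi * I * c) * e (-(b * c))) b := by
  have h : HasDerivAt (fun b : ℝ => 2 * (Real.pi : ℂ) * I * -((b : ℂ) * c))
      (-(2 * Real.pi * I * c)) b := by
    have := ((ofRealCLM.hasDerivAt (x := b)).mul_const c).neg.const_mul (2 * (Real.pi : ℂ) * I)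
    refine this.congr_deriv ?_
    rw [ofRealCLM_apply, ofReal_one]; ring
  have := h.cexp
  simp only [e]
  convert this using 1
  ring

/-- The numerators of the part of the lattice sum with a fixed multiple of `τ`, after pulling out
a factor that depends only on the row. Here `w` is the first argument shifted by that multiple,
`α = Im τ / d` and `b = d Im z₂ / Im τ`. -/
def gaussRow (α : ℝ) (w : ℂ) (b : ℝ) (n : ℤ) : ℂ :=
  Complex.exp (-(Real.pi / α) * ((w + n) * conj (w + n))) * e (-(b * (w + n)))

lemma norm_gaussRow (α : ℝ) (w : ℂ) (b : ℝ) (n : ℤ) :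
    ‖gaussRow α w b n‖ = Real.exp (2 * Real.pi * (b * w.im) - Real.pi / α * w.im ^ 2) *
      Real.exp (-(Real.pi / α) * (n + w.re) ^ 2 + 0 * n) := by
  have : -((Real.pi : ℂ) / α) * ((w + n) * conj (w + n))
      = ((-(Real.pi / α) * ((n + w.re) ^ 2 + w.im ^ 2) : ℝ) : ℂ) := by
    rw [mul_conj, normSq_apply]
    simp only [add_re, add_im, intCast_re, intCast_im]
    push_cast; ring
  rw [gaussRow, this, norm_mul, norm_e, Complex.norm_exp, ofReal_re, ← Real.exp_add, ← Real.exp_add]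
  congr 1
  simp
  ring

lemma summable_norm_gaussRow {α : ℝ} (hα : 0 < α) (w : ℂ) (b : ℝ) :
    Summable fun n => ‖gaussRow α w b n‖ := by
  simp only [norm_gaussRow]
  exact (summable_gaussian (div_pos Real.pi_pos hα) 0 w.re).mul_left _

lemma summable_div_add_int {f : ℤ → ℂ} (w : ℂ) (hf : Summable fun n => ‖f n‖) :
    Summable fun n : ℤ => f n / (w + n) := by
  refine Summable.of_norm_bounded_eventually hf ?_
  rw [Int.cofinite_eq, eventually_sup]
  have key : ∀ n : ℤ, 1 ≤ |w.re + n| → ‖f n / (w + n)‖ ≤ ‖f n‖ := fun n hn => by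
    rw [norm_div]
    refine div_le_self (norm_nonneg _) (hn.trans ?_)
    simpa using abs_re_le_norm (w + n)
  constructor
  · filter_upwards [eventually_le_atBot ⌊-w.re - 1⌋] with n hn
    have : (n : ℝ) ≤ -w.re - 1 := (Int.cast_le.2 hn).trans (Int.floor_le _)
    exact key n (le_abs.2 (Or.inr (by linarith)))
  · filter_upwards [eventually_ge_atTop ⌈-w.re + 1⌉] with n hn
    have : -w.re + 1 ≤ (n : ℝ) := (Int.le_ceil _).trans (Int.cast_le.2 hn)
    exact key n (le_abs.2 (Or.inl (by linarith)))

lemma hasDerivAt_tsum_gaussRow_div {α : ℝ} (hα : 0 < α) {w : ℂ} (hw : ∀ n : ℤ, w ≠ n) (b : ℝ) :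
    HasDerivAt (fun b : ℝ => -(1 / (2 * Real.pi * I)) * ∑' n : ℤ, gaussRow α w b n / (w + n))
      (∑' n : ℤ, gaussRow α w b n) b := by
  have hw' : ∀ n : ℤ, w + n ≠ 0 := fun n h => hw (-n) (by push_cast; linear_combination h)
  set u : ℤ → ℝ := fun n => 2 * Real.pi * (Real.exp (2 * Real.pi * ((|b| + 1) * |w.im|)
    - Real.pi / α * w.im ^ 2) * Real.exp (-(Real.pi / α) * (n + w.re) ^ 2 + 0 * n)) with hu
  have hus : Summable u :=
    ((summable_gaussian (div_pos Real.pi_pos hα) 0 w.re).mul_left _).mul_left _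
  have h := hasDerivAt_tsum_of_isPreconnected (𝕜 := ℝ) (t := Metric.ball b 1) (y₀ := b) (y := b)
    (g := fun n b => gaussRow α w b n / (w + n))
    (g' := fun n b => -(2 * Real.pi * I) * gaussRow α w b n) hus Metric.isOpen_ball
    (Metric.isConnected_ball one_pos).isPreconnected
    (fun n y _ => by
      have := ((hasDerivAt_e_const_mul (w + n) y).const_mul
        (Complex.exp (-(Real.pi / α) * ((w + n) * conj (w + n))))).div_const (w + n)
      refine this.congr_deriv ?_
      rw [gaussRow]
      field_simp [hw' n])
    (fun n y hy => by
      rw [norm_mul, norm_gaussRow, hu]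
      have h2 : ‖-(2 * (Real.pi : ℂ) * I)‖ = 2 * Real.pi := by
        simp [abs_of_pos Real.pi_pos]
      rw [h2]
      have hyb : |y| ≤ |b| + 1 := by
        have h1 := abs_sub_abs_le_abs_sub y b
        rw [Metric.mem_ball, Real.dist_eq] at hy
        linarith
      have : y * w.im ≤ (|b| + 1) * |w.im| :=
        (le_abs_self _).trans (by rw [abs_mul]; gcongr)
      have := Real.pi_pos
      refine mul_le_mul_of_nonneg_left (mul_le_mul_of_nonneg_right (Real.exp_le_exp.2 ?_)
        (Real.exp_pos _).le) (by positivity)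
      nlinarith)
    (Metric.mem_ball_self one_pos)
    (summable_div_add_int w (summable_norm_gaussRow hα w b)) (Metric.mem_ball_self one_pos)
  have h3 := h.const_mul (-(1 / (2 * (Real.pi : ℂ) * I)))
  refine h3.congr_deriv ?_
  rw [tsum_mul_left]
  have := Complex.two_pi_I_ne_zero
  field_simp

lemma norm_e_neg_int_mul (w : ℂ) (k : ℤ) :
    ‖e (-(k * w))‖ = Real.exp (2 * Real.pi * w.im * k) := by
  rw [norm_e]; congr 1; simp; ring

/-- The terms of `R` and `Theta` that belong to a fixed row, with the parameters of
`gaussRow`. -/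
def errTerm (α : ℝ) (w : ℂ) (σ : ℤ) (b : ℝ) (k : ℤ) : ℂ :=
  ((signStep σ k - E ((k + (w.im / α - b)) * √α) : ℝ) : ℂ) * e (-(k * w))

lemma summable_norm_errTerm {α : ℝ} (hα : 0 < α) (w : ℂ) (σ : ℤ) (b : ℝ) :
    Summable fun k => ‖errTerm α w σ b k‖ := by
  refine Summable.of_norm_bounded_eventually (summable_gaussian (mul_pos Real.pi_pos hα)
    (2 * Real.pi * w.im) (w.im / α - b)) ?_
  filter_upwards [eventually_abs_signStep_sub_E_le σ (w.im / α - b) (Real.sqrt_pos.2 hα)] with k hk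
  rw [norm_norm, errTerm, norm_mul, norm_e_neg_int_mul, norm_real, Real.norm_eq_abs, Real.exp_add]
  refine mul_le_mul_of_nonneg_right (hk.trans_eq ?_) (Real.exp_pos _).le
  rw [mul_pow, Real.sq_sqrt hα.le]; congr 1; ring

lemma hasDerivAt_tsum_errTerm {α : ℝ} (hα : 0 < α) (w : ℂ) (σ : ℤ) (b : ℝ) :
    HasDerivAt (fun b : ℝ => 1 / 2 * ∑' k : ℤ, errTerm α w σ b k)
      (√α * ∑' k : ℤ, (Real.exp (-(Real.pi * α) * (k + (w.im / α - b)) ^ 2) : ℂ)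
        * e (-(k * w))) b := by
  set u : ℤ → ℝ := fun k => 2 * √α * (Real.exp (Real.pi * α) *
    Real.exp (-(Real.pi * α / 2) * (k + (w.im / α - b)) ^ 2 + 2 * Real.pi * w.im * k)) with hu
  have hus : Summable u :=
    ((summable_gaussian (by have := Real.pi_pos; positivity) _ _).mul_left _).mul_left _
  have h := hasDerivAt_tsum_of_isPreconnected (𝕜 := ℝ) (t := Metric.ball b 1) (y₀ := b) (y := b)
    (g := fun k b => errTerm α w σ b k)
    (g' := fun k b => 2 * √α * ((Real.exp (-(Real.pi * α) * (k + (w.im / α - b)) ^ 2) : ℂ)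
        * e (-(k * w)))) hus Metric.isOpen_ball
    (Metric.isConnected_ball one_pos).isPreconnected
    (fun k y _ => by
      have h1 : HasDerivAt (fun b : ℝ => ((k : ℝ) + (w.im / α - b)) * √α) (-√α) y := by
        have := ((((hasDerivAt_id y).const_sub (w.im / α)).const_add (k : ℝ)).mul_const √α)
        simpa using this
      have h2 := (((hasDerivAt_E _).comp y h1).const_sub (signStep σ k)).ofReal_comp.mul_const
        (e (-(k * w)))
      refine h2.congr_deriv ?_
      rw [mul_pow, Real.sq_sqrt hα.le]
      push_cast
      ring_nf)
    (fun k y hy => by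
      rw [hu]
      beta_reduce
      rw [norm_mul, norm_mul (Complex.ofReal _), norm_e_neg_int_mul, norm_real, Real.norm_eq_abs,
        abs_of_pos (Real.exp_pos _), ← Real.exp_add, ← Real.exp_add]
      have h2 : ‖(2 * √α : ℂ)‖ = 2 * √α := by
        simp [abs_of_nonneg (Real.sqrt_nonneg α)]
      rw [h2]
      rw [Metric.mem_ball, Real.dist_eq, abs_lt] at hy
      refine mul_le_mul_of_nonneg_left (Real.exp_le_exp.2 ?_) (by positivity)
      set v := (k : ℝ) + (w.im / α - b)
      have h3 : (k : ℝ) + (w.im / α - y) = v - (y - b) := by simp only [v]; ring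
      rw [h3]
      -- A bound uniform for `|y - b| < 1`, at the cost of half the exponent.
      have h4 : v ^ 2 / 2 ≤ (v - (y - b)) ^ 2 + 1 := by nlinarith [sq_nonneg (v - 2 * (y - b))]
      have h5 : 0 < Real.pi * α := mul_pos Real.pi_pos hα
      nlinarith)
    (Metric.mem_ball_self one_pos)
    (summable_norm_errTerm hα w σ b).of_norm (Metric.mem_ball_self one_pos)
  refine (h.const_mul (1 / 2 : ℂ)).congr_deriv ?_
  rw [tsum_mul_left]; ring

/-- Poisson summation: the derivatives in `b` of the two sides of `appellRow_eq` agree. -/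
lemma tsum_gaussRow {α : ℝ} (hα : 0 < α) (w : ℂ) (b : ℝ) :
    ∑' n : ℤ, gaussRow α w b n =
      √α * ∑' k : ℤ, (Real.exp (-(Real.pi * α) * (k + (w.im / α - b)) ^ 2) : ℂ) * e (-(k * w)) := by
  have hα' : (α : ℂ) ≠ 0 := by exact_mod_cast hα.ne'
  have hpi : (Real.pi : ℂ) ≠ 0 := by exact_mod_cast Real.pi_ne_zero
  have hw : w = w.re + w.im * I := (re_add_im w).symm
  have hcw : conj w = w.re - w.im * I := by
    apply Complex.ext <;> simp
  have h := Complex.tsum_exp_neg_quadratic (a := ((1 / α : ℝ) : ℂ)) (by simpa using hα)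
    (-(w.re / α) - I * b)
  set C : ℂ := Complex.exp (-(Real.pi / α) * (w * conj w) - 2 * Real.pi * I * b * w) with hC
  have h1 : ∑' n : ℤ, gaussRow α w b n = C * ∑' n : ℤ,
      Complex.exp (-(Real.pi : ℂ) * ((1 / α : ℝ) : ℂ) * n ^ 2
        + 2 * Real.pi * (-(w.re / α) - I * b) * n) := by
    rw [← tsum_mul_left]
    refine tsum_congr fun n => ?_
    rw [gaussRow, e, hC, ← Complex.exp_add, ← Complex.exp_add]
    congr 1
    rw [map_add, hcw, map_intCast]
    generalize w.re = X at *
    generalize w.im = Y at *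
    subst hw
    push_cast
    field_simp
    ring
  have h2 : (1 / ((1 / α : ℝ) : ℂ) ^ (1 / 2 : ℂ)) = (√α : ℂ) := by
    rw [Real.sqrt_eq_rpow, ofReal_cpow hα.le, one_div α, ofReal_inv, inv_cpow, one_div, inv_inv]
    · push_cast; rfl
    · rw [arg_ofReal_of_nonneg hα.le]; exact Real.pi_pos.ne
  rw [h1, h, h2, mul_left_comm, ← tsum_mul_left]
  congr 1
  rw [← (Equiv.neg ℤ).tsum_eq]
  refine tsum_congr fun k => ?_
  rw [e, hC, Complex.ofReal_exp, ← Complex.exp_add, ← Complex.exp_add]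
  congr 1
  rw [hcw, Equiv.neg_apply]
  generalize w.re = X at *
  generalize w.im = Y at *
  subst hw
  push_cast
  field_simp
  ring_nf
  simp only [I_sq, show I ^ 3 = -I by rw [pow_succ, I_sq]; ring,
    show I ^ 4 = 1 by rw [show (4 : ℕ) = 2 * 2 by rfl, pow_mul, I_sq]; ring]
  ring

lemma errTerm_shift (α : ℝ) (w : ℂ) (σ : ℤ) (b : ℝ) (k : ℤ) :
    errTerm α w σ (b + 1) (k + 1) = e (-w) * errTerm α w (σ - 1) b k := by
  have h1 : signStep σ (k + 1) = signStep (σ - 1) k := by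
    simp only [signStep, sub_lt_iff_lt_add]
  have h2 : e (-(((k + 1 : ℤ) : ℂ) * w)) = e (-w) * e (-(k * w)) := by
    rw [← e_add]; congr 1; push_cast; ring
  rw [errTerm, errTerm, h1, h2]
  have : ((k + 1 : ℤ) : ℝ) + (w.im / α - (b + 1)) = k + (w.im / α - b) := by push_cast; ring
  rw [this]; ring

/-- Lowering `σ` by one changes only the term `k = σ`. -/
lemma errTerm_sub_one_sub (α : ℝ) (w : ℂ) (σ : ℤ) (b : ℝ) (k : ℤ) :
    errTerm α w (σ - 1) b k - errTerm α w σ b k = if k = σ then 2 * e (-(σ * w)) else 0 := by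
  rw [errTerm, errTerm, ← sub_mul, ← ofReal_sub]
  have : signStep (σ - 1) k - signStep σ k = if k = σ then 2 else 0 := by
    simp only [signStep]
    rcases lt_trichotomy k σ with h | h | h
    · rw [if_neg (by omega), if_neg (by omega), if_neg (by omega)]; norm_num
    · rw [if_pos (by omega), if_neg (by omega), if_pos h]; norm_num
    · rw [if_pos (by omega), if_pos (by omega), if_neg (by omega)]; norm_num
  rw [show ∀ x : ℝ, signStep (σ - 1) k - x - (signStep σ k - x) =
      signStep (σ - 1) k - signStep σ k by
    intro x; ring, this]
  split_ifs with h
  · rw [h]; push_cast; ring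
  · simp

/-- One term of `PhiOne` together with the part of the correction in the same row. It does not
depend on `σ`, see `appellRow_sub_one`. -/
def appellRow (α : ℝ) (w : ℂ) (σ : ℤ) (b : ℝ) : ℂ :=
  e (-(σ * w)) / (1 - e w) + 1 / 2 * ∑' k : ℤ, errTerm α w σ b k

/-- The jump of the single term `k = σ` is compensated by the change of the numerator in
`e (-σw) / (1 - e w)`. -/
lemma appellRow_sub_one {α : ℝ} (hα : 0 < α) {w : ℂ} (hw : e w ≠ 1) (σ : ℤ) (b : ℝ) :
    appellRow α w (σ - 1) b = appellRow α w σ b := by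
  have h1 : ∑' k : ℤ, errTerm α w (σ - 1) b k - ∑' k : ℤ, errTerm α w σ b k = 2 * e (-(σ * w)) := by
    rw [← (summable_norm_errTerm hα w (σ - 1) b).of_norm.tsum_sub
      (summable_norm_errTerm hα w σ b).of_norm]
    simp only [errTerm_sub_one_sub]
    rw [tsum_ite_eq]
  have h2 : e (-(((σ - 1 : ℤ) : ℂ) * w)) = e (-(σ * w)) * e w := by
    rw [← e_add]; congr 1; push_cast; ring
  have h3 : 1 - e w ≠ 0 := sub_ne_zero.2 (Ne.symm hw)
  rw [appellRow, appellRow, h2]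
  have h4 : e (-(σ * w)) * e w / (1 - e w) = e (-(σ * w)) / (1 - e w) - e (-(σ * w)) := by
    field_simp; ring
  rw [h4]
  linear_combination (1 / 2) * h1

lemma appellRow_add_one {α : ℝ} (hα : 0 < α) {w : ℂ} (hw : e w ≠ 1) (σ : ℤ) (b : ℝ) :
    appellRow α w σ (b + 1) = e (-w) * appellRow α w σ b := by
  rw [← appellRow_sub_one hα hw σ b, appellRow, appellRow, ← (Equiv.addRight (1 : ℤ)).tsum_eq]
  simp only [Equiv.coe_addRight, errTerm_shift]
  rw [tsum_mul_left, show -((σ : ℂ) * w) = -w + -(((σ - 1 : ℤ) : ℂ) * w) by push_cast; ring, e_add]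
  ring

/-- The difference of the two sides is constant in `b`, and is multiplied by `e (-w) ≠ 1` under
`b ↦ b + 1`, so it vanishes. -/
theorem appellRow_eq {α : ℝ} (hα : 0 < α) {w : ℂ} (hw : ∀ n : ℤ, w ≠ n) (σ : ℤ) (b : ℝ) :
    appellRow α w σ b = -(1 / (2 * Real.pi * I)) * ∑' n : ℤ, gaussRow α w b n / (w + n) := by
  have hew : e w ≠ 1 := fun h => by
    obtain ⟨n, hn⟩ := e_eq_one_iff.1 h
    exact hw n hn
  set D : ℝ → ℂ := fun b => appellRow α w σ b
    - -(1 / (2 * Real.pi * I)) * ∑' n : ℤ, gaussRow α w b n / (w + n) with hD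
  have hder : ∀ b, HasDerivAt D 0 b := fun b => by
    have h1 := ((hasDerivAt_tsum_errTerm hα w σ b).const_add (e (-(σ * w)) / (1 - e w))).sub
      (hasDerivAt_tsum_gaussRow_div hα hw b)
    rw [tsum_gaussRow hα w b, sub_self] at h1
    exact h1
  have hconst : D (b + 1) = D b :=
    is_const_of_deriv_eq_zero (fun x => (hder x).differentiableAt) (fun x => (hder x).deriv) _ _
  have hquasi : D (b + 1) = e (-w) * D b := by
    have h1 : ∀ n : ℤ, gaussRow α w (b + 1) n / (w + n) = e (-w) * (gaussRow α w b n / (w + n)) :=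
      fun n => by
        have : e (-(((b + 1 : ℝ) : ℂ) * (w + n))) = e (-w) * e (-(b * (w + n))) := by
          rw [← e_add, ← e_add_int _ n]; congr 1; push_cast; ring
        rw [gaussRow, gaussRow, this]; ring
    simp only [hD]
    rw [appellRow_add_one hα hew, tsum_congr h1, tsum_mul_left]
    ring
  have h3 : e (-w) ≠ 1 := fun h => by
    have : e w * e (-w) = 1 := by rw [← e_add, add_neg_cancel, e_zero]
    rw [h, mul_one] at this
    exact hew this
  have h4 : (e (-w) - 1) * D b = 0 := by linear_combination hconst - hquasi
  exact sub_eq_zero.1 ((mul_eq_zero.1 h4).resolve_left (sub_ne_zero.2 h3))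

/-! ### The lattice sum -/

/-- The term of `latticeAppell` at the lattice point `p.1 * τ + p.2`. -/
def latticeTerm (d : ℕ) (τ z₁ z₂ : ℂ) (p : ℤ × ℤ) : ℂ :=
  e (d * p.1 * z₂) *
    Complex.exp (-(Real.pi * d / τ.im) *
      ((z₁ + p.1 * τ + p.2) * (conj (z₁ + p.1 * τ + p.2) + (z₂ - conj z₂)))) /
    (z₁ + p.1 * τ + p.2)

/-- The lattice sum that represents the completed Appell function of degree `d`. Up to the
factor `-1/(2πi)` it is the average over `ℤτ + ℤ` of
`exp (-(πd / Im τ) z₁ (conj z₁ + z₂ - conj z₂)) / z₁` with respect to the elliptic action in `z₁`. -/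
def latticeAppell (d : ℕ) (τ z₁ z₂ : ℂ) : ℂ :=
  -(1 / (2 * Real.pi * I)) * ∑' p : ℤ × ℤ, latticeTerm d τ z₁ z₂ p

/-- The phases combine so that the norm of a term depends on the lattice point only through its
distance to `-z₁`. -/
lemma norm_latticeTerm (d : ℕ) {τ : ℂ} (hτ : 0 < τ.im) (z₁ z₂ : ℂ) (p : ℤ × ℤ) :
    ‖latticeTerm d τ z₁ z₂ p‖ = Real.exp (2 * Real.pi * d * (z₁.im * z₂.im) / τ.im) *
      Real.exp (-(Real.pi * d / τ.im) * ‖z₁ + p.1 * τ + p.2‖ ^ 2) / ‖z₁ + p.1 * τ + p.2‖ := by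
  rw [latticeTerm, norm_div, norm_mul, norm_e, Complex.norm_exp, ← Real.exp_add, ← Real.exp_add]
  congr 2
  rw [mul_add, mul_conj, normSq_eq_norm_sq, sub_conj]
  have h : -((Real.pi : ℂ) * d / τ.im) = ((-(Real.pi * d / τ.im) : ℝ) : ℂ) := by push_cast; ring
  rw [h, re_ofReal_mul]
  have h2 : ((d : ℂ) * p.1 * z₂).im = d * p.1 * z₂.im := by
    simp
  have h3 : ∀ r : ℝ, ((r : ℂ) ^ 2).re = r ^ 2 := fun r => by rw [← ofReal_pow, ofReal_re]
  rw [h2]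
  simp [h3]
  field_simp
  ring

lemma summable_exp_neg_norm_sq_lattice {τ : ℂ} (hτ : 0 < τ.im) (z : ℂ) {c : ℝ} (hc : 0 < c) :
    Summable fun p : ℤ × ℤ => Real.exp (-c * ‖z + p.1 * τ + p.2‖ ^ 2) := by
  set r := EisensteinSeries.r ⟨τ, hτ⟩ with hr
  have hr0 : 0 < r := EisensteinSeries.r_pos _
  have hg := summable_gaussian (A := c * r ^ 2 / 4) (by positivity) 0 0
  refine Summable.of_nonneg_of_le (fun _ => (Real.exp_pos _).le) (fun p => ?_)
    ((hg.mul_of_nonneg hg (fun _ => (Real.exp_pos _).le)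
      (fun _ => (Real.exp_pos _).le)).mul_left (Real.exp (c * ‖z‖ ^ 2)))
  rw [← Real.exp_add, ← Real.exp_add]
  refine Real.exp_le_exp.2 ?_
  obtain ⟨a, n⟩ := p
  simp only [add_zero, zero_mul]
  have h1 : r * |(a : ℝ)| ≤ ‖a * τ + n‖ ∧ r * |(n : ℝ)| ≤ ‖a * τ + n‖ := by
    by_cases hx : (![a, n] : Fin 2 → ℤ) = 0
    · have ha : a = 0 := congrFun hx 0
      have hn : n = 0 := congrFun hx 1
      simp [ha, hn]
    · have h := EisensteinSeries.r_mul_max_le ⟨τ, hτ⟩ hx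
      have e1 := norm_le_pi_norm ![a, n] 0
      have e2 := norm_le_pi_norm ![a, n] 1
      simp only [Matrix.cons_val_zero, Matrix.cons_val_one, Int.norm_eq_abs] at e1 e2 h
      exact ⟨(mul_le_mul_of_nonneg_left e1 hr0.le).trans h,
        (mul_le_mul_of_nonneg_left e2 hr0.le).trans h⟩
  -- The square norm of a lattice point is bounded below by a definite quadratic form in `a, n`.
  have h2 : ‖a * τ + n‖ ≤ ‖z + a * τ + n‖ + ‖z‖ := by
    have := norm_sub_le (z + a * τ + n) z
    rwa [show z + a * τ + n - z = a * τ + n by ring] at this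
  have h3 : r ^ 2 * (a : ℝ) ^ 2 ≤ ‖a * τ + n‖ ^ 2 := by
    rw [← sq_abs (a : ℝ), ← mul_pow]; exact pow_le_pow_left₀ (by positivity) h1.1 2
  have h4 : r ^ 2 * (n : ℝ) ^ 2 ≤ ‖a * τ + n‖ ^ 2 := by
    rw [← sq_abs (n : ℝ), ← mul_pow]; exact pow_le_pow_left₀ (by positivity) h1.2 2
  have h5 : ‖a * τ + n‖ ^ 2 ≤ 2 * ‖z + a * τ + n‖ ^ 2 + 2 * ‖z‖ ^ 2 := by
    have := pow_le_pow_left₀ (norm_nonneg _) h2 2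
    nlinarith [sq_nonneg (‖z + a * τ + n‖ - ‖z‖)]
  have h6 : r ^ 2 * (a : ℝ) ^ 2 + r ^ 2 * (n : ℝ) ^ 2
      ≤ 4 * ‖z + a * τ + n‖ ^ 2 + 4 * ‖z‖ ^ 2 := by linarith
  nlinarith [mul_le_mul_of_nonneg_left h6 hc.le]

lemma summable_latticeTerm {d : ℕ} (hd : 0 < d) {τ : ℂ} (hτ : 0 < τ.im) (z₁ z₂ : ℂ) :
    Summable (latticeTerm d τ z₁ z₂) := by
  have hc : 0 < Real.pi * d / τ.im := by have := Real.pi_pos; positivity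
  have hs := summable_exp_neg_norm_sq_lattice hτ z₁ hc
  refine Summable.of_norm_bounded_eventually
    (hs.mul_left (Real.exp (2 * Real.pi * d * (z₁.im * z₂.im) / τ.im))) ?_
  -- All but finitely many lattice points have distance more than `1` from `-z₁`, so that the
  -- denominators do no harm.
  filter_upwards [hs.tendsto_cofinite_zero.eventually_lt_const
    (Real.exp_pos (-(Real.pi * d / τ.im)))] with p hp
  rw [Real.exp_lt_exp] at hp
  rw [norm_latticeTerm d hτ]
  refine div_le_self (by positivity) ?_
  have h1 : 1 < ‖z₁ + p.1 * τ + p.2‖ ^ 2 := by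
    by_contra h
    nlinarith [not_lt.1 h]
  nlinarith [norm_nonneg (z₁ + p.1 * τ + p.2)]

lemma latticeTerm_eq_gaussRow (d : ℕ) (τ z₁ z₂ : ℂ) (a n : ℤ) :
    latticeTerm d τ z₁ z₂ (a, n) = e (d * a * z₂) *
      (gaussRow (τ.im / d) (z₁ + a * τ) (d * z₂.im / τ.im) n / (z₁ + a * τ + n)) := by
  rw [latticeTerm, gaussRow, mul_div_assoc, e, e, ← Complex.exp_add, sub_conj]
  congr 3
  push_cast
  rw [div_div_eq_mul_div]
  ring

/-! ### The product of `R` and `Theta` as a sum over rows -/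

/-- The `n`-th term of the series `R j d τ v`, where `j ≡ -n` modulo `2d` is the representative in
`[-s, -s + 2d - 1]`. -/
def rCoeff (s : ℤ) (d : ℕ) (τ v : ℂ) (n : ℤ) : ℂ :=
  ((signStep s n - E ((n + 2 * d * (v.im / τ.im)) * √(τ.im / d)) : ℝ) : ℂ) *
    Complex.exp (-((Real.pi : ℂ) * I * (n : ℂ) ^ 2 / (2 * d)) * τ - 2 * (Real.pi : ℂ) * I * n * v)

lemma summable_norm_rCoeff (s : ℤ) {d : ℕ} (hd : 0 < d) {τ : ℂ} (hτ : 0 < τ.im) (v : ℂ) :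
    Summable fun n => ‖rCoeff s d τ v n‖ := by
  have hα : 0 < τ.im / d := by positivity
  have hA : 0 < Real.pi * τ.im / (2 * d) := by have := Real.pi_pos; positivity
  refine Summable.of_norm_bounded_eventually ((summable_gaussian hA
    (-2 * Real.pi * v.im) 0).mul_left (Real.exp (-(Real.pi * (τ.im / d)) *
      (2 * d * (v.im / τ.im)) ^ 2))) ?_
  filter_upwards [eventually_abs_signStep_sub_E_le s (2 * d * (v.im / τ.im)) (Real.sqrt_pos.2 hα)]
    with n hn
  rw [norm_norm, rCoeff, norm_mul, norm_real, Real.norm_eq_abs, Complex.norm_exp]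
  refine (mul_le_mul_of_nonneg_right hn (Real.exp_pos _).le).trans_eq ?_
  rw [← Real.exp_add, ← Real.exp_add, mul_pow, Real.sq_sqrt hα.le]
  congr 1
  have h1 : -((Real.pi : ℂ) * I * (n : ℂ) ^ 2 / (2 * d)) * τ - 2 * (Real.pi : ℂ) * I * n * v
      = ((-(Real.pi * n ^ 2 / (2 * d)) : ℝ) : ℂ) * (I * τ)
        + ((-(2 * Real.pi * n) : ℝ) : ℂ) * (I * v) := by
    push_cast; ring
  rw [h1, add_re, re_ofReal_mul, re_ofReal_mul, I_mul_re, I_mul_re]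
  field_simp
  ring

/-- On the range of `j` used in `PhiAdd`, the sign in `R` depends only on `n` and `s`. -/
lemma sign_eq_signStep {s : ℕ} {d : ℕ} {j n : ℤ} (hj : j ∈ Set.Icc (-(s : ℤ)) (-s + 2 * d - 1))
    (hn : n ≡ -j [ZMOD 2 * d]) :
    Real.sign ((n : ℝ) + 1 / 2 + j - 2 * d) = signStep s n := by
  obtain ⟨l, hl⟩ := hn.symm.dvd
  obtain ⟨h1, h2⟩ := hj
  have hd : (0 : ℤ) ≤ d := by positivity
  rw [signStep]
  split_ifs with h
  · apply Real.sign_of_pos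
    have hl1 : 0 < l := by
      by_contra hc
      nlinarith [not_lt.1 hc]
    have : (2 * d : ℤ) ≤ n + j := by nlinarith
    have : (2 * d : ℝ) ≤ n + j := by exact_mod_cast this
    linarith
  · apply Real.sign_of_neg
    have hl1 : l ≤ 0 := by
      by_contra hc
      nlinarith [not_le.1 hc]
    have : n + j ≤ (0 : ℤ) := by nlinarith
    have : (n + j : ℝ) ≤ 0 := by exact_mod_cast this
    have hd0 : (1 : ℝ) ≤ d := by
      have : d ≠ 0 := by rintro rfl; simp at h2; omega
      exact_mod_cast Nat.one_le_iff_ne_zero.2 this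
    linarith

lemma Theta_congr {d : ℕ} (hd : 0 < d) {j j' : ℤ} (h : j ≡ j' [ZMOD 2 * d]) (τ z : ℂ) :
    Theta j d τ z = Theta j' d τ z := by
  obtain ⟨l, hl⟩ := h.dvd
  have hd' : (d : ℂ) ≠ 0 := by exact_mod_cast hd.ne'
  rw [Theta, Theta, ← (Equiv.addRight l).tsum_eq]
  refine tsum_congr fun n => ?_
  have hj : (j' : ℂ) = j + 2 * d * l := by
    have : j' = j + 2 * d * l := by linarith
    rw [this]; push_cast; ring
  have : ((Equiv.addRight l n : ℤ) : ℂ) + j / (2 * d) = n + j' / (2 * d) := by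
    rw [Equiv.coe_addRight, hj]; push_cast; field_simp; ring
  rw [this]

lemma sum_Icc_ite_modEq (a : ℤ) {d : ℕ} (hd : 0 < d) (n : ℤ) (f : ℂ) :
    ∑ j ∈ Finset.Icc a (a + 2 * d - 1), (if n ≡ -j [ZMOD 2 * d] then f else 0) = f := by
  have hd' : (0 : ℤ) < 2 * d := by positivity
  have h1 : ∀ j ∈ Finset.Icc a (a + 2 * d - 1),
      (n ≡ -j [ZMOD 2 * d]) ↔ j = a + (-n - a) % (2 * d) := by
    intro j hj
    rw [Finset.mem_Icc] at hj
    constructor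
    · intro h
      obtain ⟨l, hl⟩ := h.symm.dvd
      have : (-n - a) = (j - a) + (2 * d) * (-l) := by linarith
      rw [this, Int.add_mul_emod_self_left, Int.emod_eq_of_lt (by omega) (by omega)]
      ring
    · rintro h
      have := Int.emod_add_mul_ediv (-n - a) (2 * d)
      refine Int.ModEq.symm ((Int.modEq_iff_dvd).2 ⟨-((-n - a) / (2 * d)), ?_⟩)
      rw [h]
      linarith
  rw [Finset.sum_congr rfl fun j hj => if_congr (h1 j hj) rfl rfl, Finset.sum_ite_eq', if_pos]
  rw [Finset.mem_Icc]
  have := Int.emod_nonneg (-n - a) hd'.ne'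
  have := Int.emod_lt_of_pos (-n - a) hd'
  omega

/-- The terms of the theta functions of degree `d`, indexed by
`n = 2dk + j = 2d (k + j/(2d))`, so that each residue class of `n` modulo `2d` gives one `Theta j`. -/
def thetaTerm (d : ℕ) (τ x : ℂ) (n : ℤ) : ℂ := e (n / 2 * x) * e (n ^ 2 / (4 * d) * τ)

lemma summable_norm_thetaTerm {d : ℕ} (hd : 0 < d) {τ : ℂ} (hτ : 0 < τ.im) (x : ℂ) :
    Summable fun n => ‖thetaTerm d τ x n‖ := by
  have hA : 0 < Real.pi * τ.im / (2 * d) := by have := Real.pi_pos; positivity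
  refine (summable_gaussian hA (-Real.pi * x.im) 0).congr fun n => ?_
  rw [thetaTerm, norm_mul, norm_e, norm_e, ← Real.exp_add]
  congr 1
  have h1 : (n : ℂ) / 2 * x = ((n / 2 : ℝ) : ℂ) * x := by push_cast; ring
  have h2 : (n : ℂ) ^ 2 / (4 * d) * τ = ((n ^ 2 / (4 * d) : ℝ) : ℂ) * τ := by push_cast; ring
  rw [h1, h2, im_ofReal_mul, im_ofReal_mul]
  field_simp
  ring

lemma Theta_neg_eq {d : ℕ} (hd : 0 < d) (τ x : ℂ) (n : ℤ) :
    Theta (-n) d τ x = ∑' k : ℤ, thetaTerm d τ x (2 * d * k - n) := by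
  have hd' : (d : ℂ) ≠ 0 := by exact_mod_cast hd.ne'
  refine tsum_congr fun k => ?_
  rw [thetaTerm]
  congr 2 <;> · push_cast; field_simp; ring

lemma summable_rCoeff_mul_thetaTerm (s : ℤ) {d : ℕ} (hd : 0 < d) {τ : ℂ} (hτ : 0 < τ.im)
    (v x : ℂ) :
    Summable fun p : ℤ × ℤ => rCoeff s d τ v p.1 * thetaTerm d τ x (2 * d * p.2 - p.1) := by
  have h := (summable_norm_rCoeff s hd hτ v).mul_of_nonneg (summable_norm_thetaTerm hd hτ x)
    (fun _ => norm_nonneg _) (fun _ => norm_nonneg _)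
  have hinj : Function.Injective fun p : ℤ × ℤ => (p.1, 2 * (d : ℤ) * p.2 - p.1) := by
    rintro ⟨n, k⟩ ⟨n', k'⟩ h
    simp only [Prod.mk.injEq] at h
    obtain ⟨rfl, h⟩ := h
    have : (2 * (d : ℤ)) * k = 2 * d * k' := by linarith
    rw [mul_left_cancel₀ (by positivity) this]
  refine Summable.of_norm ((h.comp_injective hinj).congr fun p => ?_)
  rw [norm_mul]; rfl

lemma R_mul_Theta (s : ℕ) {d : ℕ} (hd : 0 < d) (τ v x : ℂ) {j : ℤ}
    (hj : j ∈ Set.Icc (-(s : ℤ)) (-s + 2 * d - 1)) :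
    R j d τ v * Theta j d τ x =
      ∑' n : ℤ, {n : ℤ | n ≡ -j [ZMOD 2 * d]}.indicator
        (fun n => rCoeff s d τ v n * Theta (-n) d τ x) n := by
  rw [← tsum_subtype {n : ℤ | n ≡ -j [ZMOD 2 * d]}, R, ← tsum_mul_right]
  refine tsum_congr fun n => ?_
  have hn : (n : ℤ) ≡ -j [ZMOD 2 * d] := n.2
  rw [Theta_congr hd (show j ≡ -(n : ℤ) [ZMOD 2 * d] by simpa using hn.symm.neg), rCoeff,
    sign_eq_signStep hj hn]

lemma sum_R_mul_Theta (s : ℕ) {d : ℕ} (hd : 0 < d) {τ : ℂ} (hτ : 0 < τ.im) (v x : ℂ) :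
    ∑ j ∈ Finset.Icc (-(s : ℤ)) (-s + 2 * d - 1), R j d τ v * Theta j d τ x =
      ∑' k : ℤ, ∑' n : ℤ, rCoeff s d τ v n * thetaTerm d τ x (2 * d * k - n) := by
  have hsum := summable_rCoeff_mul_thetaTerm s hd hτ v x
  have hsum' : Summable (Function.uncurry fun n k : ℤ =>
    rCoeff s d τ v n * thetaTerm d τ x (2 * d * k - n)) := hsum
  have h1 : ∀ n : ℤ, ∑' k : ℤ, rCoeff s d τ v n * thetaTerm d τ x (2 * d * k - n)
      = rCoeff s d τ v n * Theta (-n) d τ x := fun n => by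
    rw [tsum_mul_left, Theta_neg_eq hd]
  have hsum2 : Summable fun n : ℤ => rCoeff s d τ v n * Theta (-n) d τ x := by
    simp only [← h1]
    exact hsum.prod
  rw [hsum'.tsum_comm, tsum_congr h1, Finset.sum_congr rfl fun j hj => R_mul_Theta s hd τ v x
    (Set.mem_Icc.2 (Finset.mem_Icc.1 hj)), ← Summable.tsum_finsetSum]
  · refine tsum_congr fun n => ?_
    simp only [Set.indicator_apply, Set.mem_ofPred_eq]
    exact sum_Icc_ite_modEq _ hd n _
  · intro j _
    exact hsum2.indicator _

/-- The index `n + dk` of `R` and the index `dk - n` of `Theta` combine to row `k` of the lattice. -/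
lemma rCoeff_mul_thetaTerm (s : ℤ) {d : ℕ} (hd : 0 < d) {τ : ℂ} (hτ : 0 < τ.im) (z₁ z₂ : ℂ)
    (k n : ℤ) :
    rCoeff s d τ ((z₁ - z₂) / 2) (n + d * k) * thetaTerm d τ (z₁ + z₂) (2 * d * k - (n + d * k)) =
      e (d * k * z₂) *
        errTerm (τ.im / d) (z₁ + k * τ) (s - d * k) (d * z₂.im / τ.im) n := by
  have hd' : (d : ℂ) ≠ 0 := by exact_mod_cast hd.ne'
  have hd'' : (d : ℝ) ≠ 0 := by exact_mod_cast hd.ne'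
  have h1 : signStep (s - d * k) n = signStep s (n + d * k) := by
    simp only [signStep, sub_lt_iff_lt_add]
  have h2 : ((n + d * k : ℤ) : ℝ) + 2 * d * (((z₁ - z₂) / 2).im / τ.im)
      = n + ((z₁ + k * τ).im / (τ.im / d) - d * z₂.im / τ.im) := by
    have : ((z₁ - z₂) / 2).im = (z₁.im - z₂.im) / 2 := by simp
    rw [this]
    simp
    field_simp
    ring
  rw [rCoeff, errTerm, h1, h2, mul_left_comm, mul_assoc]
  congr 1
  rw [thetaTerm, e, e, e, e, ← Complex.exp_add, ← Complex.exp_add, ← Complex.exp_add]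
  congr 1
  push_cast
  field_simp
  ring

/-! ### The completed Appell function as a lattice sum -/

/-- The completed Appell function is a lattice sum. -/
theorem PhiOne_add_eq_latticeAppell (m s : ℕ) {τ z₁ : ℂ} (z₂ : ℂ) (hτ : 0 < τ.im)
    (hz₁ : ∀ a b : ℤ, z₁ ≠ a + b * τ) :
    PhiOne m s τ z₁ z₂ + 1 / 2 * ∑ j ∈ Finset.Icc (-(s : ℤ)) (-(s : ℤ) + 2 * m + 1),
      R j (m + 1) τ ((z₁ - z₂) / 2) * Theta j (m + 1) τ (z₁ + z₂)
      = latticeAppell (m + 1) τ z₁ z₂ := by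
  set d : ℕ := m + 1 with hd
  have hd0 : 0 < d := Nat.succ_pos m
  have hα : 0 < τ.im / d := by positivity
  have hI : -(s : ℤ) + 2 * m + 1 = -s + 2 * d - 1 := by rw [hd]; push_cast; ring
  rw [hI, sum_R_mul_Theta s hd0 hτ]
  have hsl := summable_latticeTerm hd0 hτ z₁ z₂
  have hsr := summable_rCoeff_mul_thetaTerm s hd0 hτ ((z₁ - z₂) / 2) (z₁ + z₂)
  have hrow : ∀ k : ℤ, e (-((((s : ℤ) - d * k : ℤ) : ℂ) * (z₁ + k * τ))) / (1 - e (z₁ + k * τ))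
      * e (d * k * z₂) = -(1 / (2 * Real.pi * I)) * ∑' n : ℤ, latticeTerm d τ z₁ z₂ (k, n)
      - 1 / 2 * ∑' n : ℤ, rCoeff s d τ ((z₁ - z₂) / 2) n *
        thetaTerm d τ (z₁ + z₂) (2 * d * k - n) := fun k => by
    have hw : ∀ n : ℤ, z₁ + k * τ ≠ n := fun n h => hz₁ n (-k) (by
      push_cast; linear_combination h)
    have h := appellRow_eq hα hw ((s : ℤ) - d * k) (d * z₂.im / τ.im)
    rw [← (Equiv.addRight ((d : ℤ) * k)).tsum_eq (fun n : ℤ => rCoeff s d τ ((z₁ - z₂) / 2) n *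
        thetaTerm d τ (z₁ + z₂) (2 * d * k - n))]
    simp only [Equiv.coe_addRight, rCoeff_mul_thetaTerm _ hd0 hτ, latticeTerm_eq_gaussRow]
    rw [tsum_mul_left, tsum_mul_left]
    rw [appellRow] at h
    linear_combination e (d * k * z₂) * h
  have hPhi : PhiOne m s τ z₁ z₂ = ∑' k : ℤ,
      (-(1 / (2 * Real.pi * I)) * ∑' n : ℤ, latticeTerm d τ z₁ z₂ (k, n)
      - 1 / 2 * ∑' n : ℤ, rCoeff s d τ ((z₁ - z₂) / 2) n *
        thetaTerm d τ (z₁ + z₂) (2 * d * k - n)) := by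
    refine tsum_congr fun k => ?_
    rw [← hrow k, ← e_add z₁, ← e_add, ← e_add, div_mul_eq_mul_div, ← e_add]
    congr 2
    rw [hd]; push_cast; ring
  have hsr' : Summable fun k : ℤ => ∑' n : ℤ, rCoeff s d τ ((z₁ - z₂) / 2) n *
      thetaTerm d τ (z₁ + z₂) (2 * d * k - n) := hsr.prod_symm.prod
  rw [hPhi, Summable.tsum_sub (hsl.prod.mul_left _) (hsr'.mul_left _),
    tsum_mul_left, tsum_mul_left, latticeAppell, hsl.tsum_prod]
  ring

lemma latticeAppell_neg_neg (d : ℕ) (τ z₁ z₂ : ℂ) :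
    latticeAppell d τ (-z₁) (-z₂) = -latticeAppell d τ z₁ z₂ := by
  have h : ∀ p : ℤ × ℤ, latticeTerm d τ (-z₁) (-z₂) (-p) = -latticeTerm d τ z₁ z₂ p := fun p => by
    have hu : -z₁ + ((-p).1 : ℂ) * τ + ((-p).2 : ℂ) = -(z₁ + p.1 * τ + p.2) := by
      simp only [Prod.fst_neg, Prod.snd_neg]; push_cast; ring
    simp only [latticeTerm, hu, map_neg]
    rw [div_neg]
    congr 4
    · simp
    · ring
  rw [latticeAppell, latticeAppell, ← (Equiv.neg (ℤ × ℤ)).tsum_eq]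
  simp only [Equiv.neg_apply, h]
  rw [tsum_neg, mul_neg]

lemma Theta_neg (j : ℤ) (d : ℕ) (τ z : ℂ) : Theta j d τ (-z) = Theta (-j) d τ z := by
  rw [Theta, Theta, ← (Equiv.neg ℤ).tsum_eq]
  refine tsum_congr fun n => ?_
  simp only [Equiv.neg_apply]
  congr 2 <;> · push_cast; ring

theorem PhiTilde_eq (m s : ℕ) {τ z₁ z₂ : ℂ} (t : ℂ) (hτ : 0 < τ.im)
    (hz₁ : ∀ a b : ℤ, z₁ ≠ a + b * τ) (hz₂ : ∀ a b : ℤ, z₂ ≠ a + b * τ) :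
    PhiTilde m s τ z₁ z₂ t = e ((m + 1) * t) *
      (latticeAppell (m + 1) τ z₁ z₂ + latticeAppell (m + 1) τ z₂ z₁) := by
  have hz₂' : ∀ a b : ℤ, -z₂ ≠ a + b * τ := fun a b h =>
    hz₂ (-a) (-b) (by push_cast; linear_combination -h)
  have h1 := PhiOne_add_eq_latticeAppell m s z₂ hτ hz₁
  have h2 := PhiOne_add_eq_latticeAppell m s (-z₁) hτ hz₂'
  rw [latticeAppell_neg_neg] at h2
  simp only [show -z₂ + -z₁ = -(z₁ + z₂) by ring, show -z₂ - -z₁ = z₁ - z₂ by ring,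
    Theta_neg] at h2
  rw [PhiTilde, Phi, PhiAdd]
  simp only [mul_sub, Finset.sum_sub_distrib]
  linear_combination e ((m + 1) * t) * (h1 - h2)

/-! ### Shifts, inversion and distribution -/

/-- The term at the lattice point `bτ + n` of the lattice sums of index `d/M`, which arise for the
period `Mτ` as well as for the period `-M/τ`. -/
def coarseTerm (M d : ℕ) (τ z₁ z₂ : ℂ) (b n : ℤ) : ℂ :=
  e (d / M * b * z₂) *
    Complex.exp (-(Real.pi * d / (M * τ.im)) *
      ((z₁ + b * τ + n) * (conj (z₁ + b * τ + n) + (z₂ - conj z₂)))) / (z₁ + b * τ + n)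

/-- The analogue of `shiftedPhiTilde` for `latticeAppell`. -/
def shiftedLattice (M d : ℕ) (j k : ℤ) (τ z₁ z₂ : ℂ) : ℂ :=
  e (d / M * j * k * τ) * e (d / M * (k * z₁ + j * z₂)) *
    latticeAppell d (M * τ) (z₁ + j * τ) (z₂ + k * τ)

/-- After shifting by `(jτ, kτ)`, the index `k` appears only in a root of unity, and `j` only through
the lattice point. -/
lemma prefactor_mul_latticeTerm {M : ℕ} (hM : 0 < M) (d : ℕ) {τ : ℂ} (hτ : 0 < τ.im) (z₁ z₂ : ℂ)
    (j k : ℤ) (p : ℤ × ℤ) :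
    e (d / M * j * k * τ) * e (d / M * (k * z₁ + j * z₂)) *
      latticeTerm d (M * τ) (z₁ + j * τ) (z₂ + k * τ) p =
      e (-(d / M * k * p.2)) * coarseTerm M d τ z₁ z₂ (j + p.1 * M) p.2 := by
  obtain ⟨a, n⟩ := p
  have hM' : (M : ℂ) ≠ 0 := by exact_mod_cast hM.ne'
  have hy : (τ.im : ℂ) ≠ 0 := by exact_mod_cast hτ.ne'
  have hu : z₁ + j * τ + a * (M * τ) + n = z₁ + ((j + a * M : ℤ) : ℂ) * τ + n := by push_cast; ring
  have hconj : z₂ + k * τ - conj (z₂ + k * τ) = z₂ - conj z₂ + 2 * k * τ.im * I := by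
    have := sub_conj τ
    simp only [map_add, map_mul, map_intCast]
    push_cast at this
    linear_combination k * this
  have him : ((M : ℂ) * τ).im = M * τ.im := by simp
  simp only [latticeTerm, coarseTerm]
  rw [hu, hconj, him, ← mul_div_assoc, ← mul_div_assoc]
  congr 1
  set u := z₁ + ((j + a * M : ℤ) : ℂ) * τ + n with hu'
  simp only [e]
  rw [← Complex.exp_add, ← Complex.exp_add, ← Complex.exp_add, ← Complex.exp_add,
    ← Complex.exp_add]
  congr 1
  generalize hc : conj u + (z₂ - conj z₂) = c
  rw [show conj u + (z₂ - conj z₂ + 2 * k * τ.im * I) = c + 2 * k * τ.im * I by rw [← hc]; ring,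
    hu']
  push_cast
  field_simp
  ring

lemma shiftedLattice_eq_tsum {M : ℕ} (hM : 0 < M) (d : ℕ) {τ : ℂ} (hτ : 0 < τ.im) (z₁ z₂ : ℂ)
    (j k : ℤ) :
    shiftedLattice M d j k τ z₁ z₂ = -(1 / (2 * Real.pi * I)) *
      ∑' p : ℤ × ℤ, e (-(d / M * k * p.2)) * coarseTerm M d τ z₁ z₂ (j + p.1 * M) p.2 := by
  simp only [← prefactor_mul_latticeTerm hM d hτ]
  rw [tsum_mul_left, shiftedLattice, latticeAppell]
  ring

lemma summable_phase_mul_coarseTerm {M : ℕ} (hM : 0 < M) {d : ℕ} (hd : 0 < d) {τ : ℂ}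
    (hτ : 0 < τ.im) (z₁ z₂ : ℂ) (j k : ℤ) :
    Summable fun p : ℤ × ℤ =>
      e (-(d / M * k * p.2)) * coarseTerm M d τ z₁ z₂ (j + p.1 * M) p.2 := by
  have hMτ : 0 < ((M : ℂ) * τ).im := by
    rw [← ofReal_natCast, im_ofReal_mul]; positivity
  simp only [← prefactor_mul_latticeTerm hM d hτ]
  exact (summable_latticeTerm hd hMτ _ _).mul_left _

theorem shiftedLattice_congr {M : ℕ} (hM : 0 < M) (d : ℕ) {τ : ℂ} (hτ : 0 < τ.im) (z₁ z₂ : ℂ)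
    {j k j' k' : ℤ} (hj : j ≡ j' [ZMOD M]) (hk : k ≡ k' [ZMOD M]) :
    shiftedLattice M d j k τ z₁ z₂ = shiftedLattice M d j' k' τ z₁ z₂ := by
  have hM' : (M : ℂ) ≠ 0 := by exact_mod_cast hM.ne'
  obtain ⟨a, ha⟩ := hj.dvd
  obtain ⟨b, hb⟩ := hk.dvd
  have hk' : (k' : ℂ) = k + M * b := by
    rw [show k' = k + M * b by linarith]; push_cast; ring
  rw [shiftedLattice_eq_tsum hM d hτ, shiftedLattice_eq_tsum hM d hτ,
    ← ((Equiv.addRight a).prodCongr (Equiv.refl ℤ)).tsum_eq]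
  congr 1
  refine tsum_congr fun p => ?_
  simp only [Equiv.prodCongr_apply, Equiv.coe_refl, Equiv.coe_addRight, Prod.map_fst, Prod.map_snd,
    id]
  congr 1
  · rw [← e_add_int _ (-(d * b * p.2)), hk']
    congr 1
    push_cast
    field_simp
    ring
  · congr 1
    linear_combination -ha

/-- The Jacobi factor comes from `conj τ / τ = 1 - 2i Im τ / τ`. -/
lemma latticeTerm_inversion {M : ℕ} (hM : 0 < M) (d : ℕ) {τ : ℂ} (hτ : 0 < τ.im) (z₁ z₂ : ℂ)
    (a n : ℤ) :
    latticeTerm d (-M / τ) (z₁ / τ) (z₂ / τ) (a, n) =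
      τ * e (d * z₁ * z₂ / (M * τ)) * coarseTerm M d τ z₁ z₂ n (M * -a) := by
  have hM' : (M : ℂ) ≠ 0 := by exact_mod_cast hM.ne'
  have hy : (τ.im : ℂ) ≠ 0 := by exact_mod_cast hτ.ne'
  have hτ0 : τ ≠ 0 := by rintro rfl; simp at hτ
  have hcτ0 : conj τ ≠ 0 := by simpa using hτ0
  have him : (((-(M : ℂ) / τ).im : ℝ) : ℂ) = M * τ.im / (τ * conj τ) := by
    rw [← ofReal_natCast, ← ofReal_neg, mul_conj, div_eq_mul_inv, im_ofReal_mul, inv_im]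
    push_cast; ring
  have hu : z₁ / τ + a * (-M / τ) + n = (z₁ + n * τ + ((M * -a : ℤ) : ℂ)) / τ := by
    push_cast; field_simp; ring
  simp only [latticeTerm, coarseTerm]
  rw [hu, him, div_div_eq_mul_div]
  set u := z₁ + n * τ + ((M * -a : ℤ) : ℂ) with hu'
  suffices h : e (d * a * (z₂ / τ)) * Complex.exp (-(Real.pi * d / (M * τ.im / (τ * conj τ))) *
      (u / τ * (conj (u / τ) + (z₂ / τ - conj (z₂ / τ))))) = e (d * z₁ * z₂ / (M * τ)) *
      (e (d / M * n * z₂) *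
        Complex.exp (-(Real.pi * d / (M * τ.im)) * (u * (conj u + (z₂ - conj z₂))))) by
    rw [h]; ring
  simp only [e]
  rw [← Complex.exp_add, ← Complex.exp_add, ← Complex.exp_add]
  congr 1
  have hcz : conj τ = τ - 2 * τ.im * I := by
    have := sub_conj τ; push_cast at this; linear_combination -this
  rw [map_div₀, map_div₀]
  have e1 : -(Real.pi * d / (M * τ.im / (τ * conj τ))) *
      (u / τ * (conj u / conj τ + (z₂ / τ - conj z₂ / conj τ)))
      = -(Real.pi * d / (M * τ.im)) * (u * (conj u + (z₂ * (conj τ / τ) - conj z₂))) := by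
    field_simp
  have e2 : z₂ * (conj τ / τ) = z₂ - 2 * τ.im * I * z₂ / τ := by
    rw [hcz]; field_simp
  rw [e1, e2]
  generalize conj u = cu
  generalize conj z₂ = cz
  rw [hu']
  push_cast
  field_simp
  ring

lemma sum_range_e {M d : ℕ} (hM : 0 < M) (hd : Nat.Coprime M d) (n : ℤ) :
    ∑ k ∈ Finset.range M, e (-(d / M * (k : ℤ) * n)) = if (M : ℤ) ∣ n then (M : ℂ) else 0 := by
  have hM' : (M : ℂ) ≠ 0 := by exact_mod_cast hM.ne'
  set ζ := e (-(d / M * n)) with hζ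
  have hpow : ∀ k : ℕ, e (-(d / M * (k : ℤ) * n)) = ζ ^ k := fun k => by
    rw [hζ, e, e, ← Complex.exp_nat_mul]
    congr 1; push_cast; ring
  simp only [hpow]
  split_ifs with h
  · obtain ⟨l, rfl⟩ := h
    have : ζ = 1 := by
      rw [hζ, e_eq_one_iff]
      exact ⟨-(d * l), by push_cast; field_simp⟩
    simp [this]
  · have h1 : ζ ≠ 1 := fun h1 => by
      obtain ⟨l, hl⟩ := e_eq_one_iff.1 h1
      refine h ((Nat.isCoprime_iff_coprime.2 hd).dvd_of_dvd_mul_left ⟨-l, ?_⟩)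
      have : (d : ℂ) * n = M * -l := by rw [← hl]; field_simp
      exact_mod_cast this
    have h2 : ζ ^ M = 1 := by
      rw [← hpow, e_eq_one_iff]
      exact ⟨-(d * n), by push_cast; field_simp⟩
    have h3 := geom_sum_mul ζ M
    rw [h2, sub_self] at h3
    exact (mul_eq_zero.1 h3).resolve_right (sub_ne_zero.2 h1)

/-- Splitting the first index of a double series into residue classes modulo `M`. -/
lemma tsum_eq_sum_range_tsum {M : ℕ} (hM : 0 < M) {F : ℤ → ℤ → ℂ}
    (hF : Summable fun p : ℤ × ℤ => F p.1 p.2) :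
    ∑' p : ℤ × ℤ, F p.1 p.2 = ∑ j ∈ Finset.range M, ∑' p : ℤ × ℤ, F (j + p.1 * M) p.2 := by
  have : NeZero M := ⟨hM.ne'⟩
  obtain ⟨ε, hε⟩ : ∃ ε : Fin M × (ℤ × ℤ) ≃ ℤ × ℤ,
      ∀ q, ε q = ((q.1 : ℕ) + q.2.1 * (M : ℤ), q.2.2) :=
    ⟨((Equiv.prodAssoc _ _ _).symm.trans ((Equiv.prodComm _ _).prodCongr (Equiv.refl ℤ))).trans
      ((Int.divModEquiv M).symm.prodCongr (Equiv.refl ℤ)), fun q => by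
        simp [Int.divModEquiv, add_comm]⟩
  have hFε : Summable fun q : Fin M × (ℤ × ℤ) => F (ε q).1 (ε q).2 :=
    (ε.summable_iff (f := fun p : ℤ × ℤ => F p.1 p.2)).2 hF
  rw [← ε.tsum_eq, hFε.tsum_prod, tsum_fintype,
    ← Fin.sum_univ_eq_sum_range (fun j : ℕ => ∑' p : ℤ × ℤ, F (j + p.1 * M) p.2)]
  simp only [hε]

/-- The sum of `coarseTerm` over the sublattice `ℤτ + Mℤ`. -/
def coarseSum (M d : ℕ) (τ z₁ z₂ : ℂ) : ℂ :=
  -(1 / (2 * Real.pi * I)) * ∑' p : ℤ × ℤ, coarseTerm M d τ z₁ z₂ p.1 (M * p.2)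

/-- The map `(a, n) ↦ (n, -a)`, by which multiplication by `τ` sends the lattice `ℤ(-M/τ) + ℤ`
to `ℤτ + Mℤ`. -/
def swapNeg : ℤ × ℤ ≃ ℤ × ℤ := (Equiv.prodComm ℤ ℤ).trans ((Equiv.refl ℤ).prodCongr (Equiv.neg ℤ))

lemma latticeAppell_inversion {M : ℕ} (hM : 0 < M) (d : ℕ) {τ : ℂ} (hτ : 0 < τ.im) (z₁ z₂ : ℂ) :
    latticeAppell d (-M / τ) (z₁ / τ) (z₂ / τ) =
      τ * e (d * z₁ * z₂ / (M * τ)) * coarseSum M d τ z₁ z₂ := by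
  have h : ∀ p : ℤ × ℤ, latticeTerm d (-M / τ) (z₁ / τ) (z₂ / τ) p =
      τ * e (d * z₁ * z₂ / (M * τ)) *
        coarseTerm M d τ z₁ z₂ (swapNeg p).1 (M * (swapNeg p).2) := fun p =>
    latticeTerm_inversion hM d hτ z₁ z₂ p.1 p.2
  rw [latticeAppell, coarseSum, tsum_congr h, tsum_mul_left,
    swapNeg.tsum_eq fun p : ℤ × ℤ => coarseTerm M d τ z₁ z₂ p.1 (M * p.2)]
  ring

lemma neg_natCast_div_im_pos {M : ℕ} (hM : 0 < M) {τ : ℂ} (hτ : 0 < τ.im) :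
    0 < (-(M : ℂ) / τ).im := by
  have hτ0 : τ ≠ 0 := by rintro rfl; simp at hτ
  rw [← ofReal_natCast, ← ofReal_neg, div_eq_mul_inv, im_ofReal_mul, inv_im]
  have := normSq_pos.2 hτ0
  rw [mul_div_assoc', neg_mul_neg]
  positivity

lemma summable_coarseTerm {M : ℕ} (hM : 0 < M) {d : ℕ} (hd : 0 < d) {τ : ℂ} (hτ : 0 < τ.im)
    (z₁ z₂ : ℂ) :
    Summable fun p : ℤ × ℤ => coarseTerm M d τ z₁ z₂ p.1 (M * p.2) := by
  have hτ0 : τ ≠ 0 := by rintro rfl; simp at hτ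
  have h := summable_latticeTerm hd (neg_natCast_div_im_pos hM hτ) (z₁ / τ) (z₂ / τ)
  refine swapNeg.summable_iff.1 ((h.mul_left (τ * e (d * z₁ * z₂ / (M * τ)))⁻¹).congr fun p => ?_)
  rw [show p = (p.1, p.2) from rfl, latticeTerm_inversion hM d hτ,
    inv_mul_cancel_left₀ (mul_ne_zero hτ0 (e_ne_zero _))]
  rfl

/-- Summing over `j` joins the lattices `jτ + ℤMτ + ℤ` to `ℤτ + ℤ`; summing over `k` then cuts out
the sublattice `ℤτ + Mℤ`, by `sum_range_e`. -/
theorem sum_shiftedLattice {M : ℕ} (hM : 0 < M) {d : ℕ} (hd : 0 < d) (hMd : Nat.Coprime M d)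
    {τ : ℂ} (hτ : 0 < τ.im) (z₁ z₂ : ℂ) :
    ∑ j ∈ Finset.range M, ∑ k ∈ Finset.range M, shiftedLattice M d j k τ z₁ z₂ =
      M * coarseSum M d τ z₁ z₂ := by
  set F : ℤ → ℤ → ℂ := fun b n => if (M : ℤ) ∣ n then coarseTerm M d τ z₁ z₂ b n else 0 with hF
  have hinj : Function.Injective fun p : ℤ × ℤ => (p.1, (M : ℤ) * p.2) := by
    rintro ⟨b, n⟩ ⟨b', n'⟩ h
    simp only [Prod.mk.injEq] at h
    obtain ⟨rfl, h⟩ := h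
    rw [mul_left_cancel₀ (by positivity) h]
  have hFM : (fun p : ℤ × ℤ => F p.1 p.2) ∘ (fun p : ℤ × ℤ => (p.1, (M : ℤ) * p.2)) =
      fun p : ℤ × ℤ => coarseTerm M d τ z₁ z₂ p.1 (M * p.2) := by
    funext p
    simp [hF]
  have hF0 : ∀ p ∉ Set.range (fun p : ℤ × ℤ => (p.1, (M : ℤ) * p.2)), F p.1 p.2 = 0 := by
    rintro ⟨b, n⟩ hp
    simp only [hF]
    refine if_neg fun ⟨l, hl⟩ => hp ⟨(b, l), by simp [hl]⟩
  have hFs : Summable fun p : ℤ × ℤ => F p.1 p.2 := by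
    rw [← hinj.summable_iff hF0, hFM]
    exact summable_coarseTerm hM hd hτ z₁ z₂
  have hFt : ∑' p : ℤ × ℤ, F p.1 p.2 =
      ∑' p : ℤ × ℤ, coarseTerm M d τ z₁ z₂ p.1 (M * p.2) := by
    rw [← hFM]
    exact (hinj.tsum_eq (f := fun p : ℤ × ℤ => F p.1 p.2)
      (fun p hp => by_contra fun h => hp (hF0 p h))).symm
  rw [coarseSum, ← hFt, tsum_eq_sum_range_tsum hM hFs, mul_left_comm, Finset.mul_sum,
    Finset.mul_sum]
  refine Finset.sum_congr rfl fun j _ => ?_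
  simp only [shiftedLattice_eq_tsum hM d hτ]
  have hcomm := Summable.tsum_finsetSum (s := Finset.range M)
    (fun (k : ℕ) _ => summable_phase_mul_coarseTerm hM hd hτ z₁ z₂ j k)
  rw [← Finset.mul_sum, ← hcomm]
  congr 1
  rw [← tsum_mul_left]
  refine tsum_congr fun p => ?_
  rw [← Finset.sum_mul, sum_range_e hM hMd]
  simp only [hF]
  split_ifs <;> simp

lemma shiftedPhiTilde_eq {M : ℕ} (hM : 0 < M) (m s : ℕ) (j k : ℤ) {τ z₁ z₂ : ℂ} (t : ℂ)
    (hτ : 0 < τ.im) (hz₁ : ∀ a b : ℤ, z₁ ≠ a + b * τ) (hz₂ : ∀ a b : ℤ, z₂ ≠ a + b * τ) :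
    shiftedPhiTilde M m s j k τ z₁ z₂ t = e ((m + 1) * t) *
      (shiftedLattice M (m + 1) j k τ z₁ z₂ + shiftedLattice M (m + 1) k j τ z₂ z₁) := by
  have hMτ : 0 < ((M : ℂ) * τ).im := by
    rw [← ofReal_natCast, im_ofReal_mul]; positivity
  have hsh : ∀ (l : ℤ) {z : ℂ}, (∀ a b : ℤ, z ≠ a + b * τ) →
      ∀ a b : ℤ, z + l * τ ≠ a + b * (M * τ) := fun l z hz a b h =>
    hz a (b * M - l) (by push_cast; linear_combination h)
  rw [shiftedPhiTilde, PhiTilde_eq m s t hMτ (hsh j hz₁) (hsh k hz₂), shiftedLattice,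
    shiftedLattice]
  rw [show ((m + 1 : ℕ) : ℂ) / M * k * j * τ = (m + 1) / M * j * k * τ by push_cast; ring,
    show ((m + 1 : ℕ) : ℂ) / M * (j * z₂ + k * z₁) = (m + 1) / M * (k * z₁ + j * z₂) by
      push_cast; ring]
  push_cast
  ring

end

end MockTheta

open MockTheta in
theorem theorem2p2 (M m s : ℕ) (hM : 0 < M) (hs : s ≤ m)
    (hgcd : 0 < m → Nat.gcd M (2 * m + 2) = 1)
    (τ z₁ z₂ t : ℂ) (hτ : 0 < τ.im)
    (hz₁ : ∀ a b : ℤ, z₁ ≠ a + b * τ) (hz₂ : ∀ a b : ℤ, z₂ ≠ a + b * τ) :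
    (∀ j k j' k' : ℤ, j ≡ j' [ZMOD M] → k ≡ k' [ZMOD M] →
      MockTheta.shiftedPhiTilde M m s j k τ z₁ z₂ t
        = MockTheta.shiftedPhiTilde M m s j' k' τ z₁ z₂ t) ∧
    MockTheta.PhiTilde m s (-M / τ) (z₁ / τ) (z₂ / τ) (t - z₁ * z₂ / (τ * M))
      = τ / M * ∑ j ∈ Finset.range M, ∑ k ∈ Finset.range M,
          MockTheta.shiftedPhiTilde M m s j k τ z₁ z₂ t := by
  have hM' : (M : ℂ) ≠ 0 := by exact_mod_cast hM.ne'
  have hτ0 : τ ≠ 0 := by rintro rfl; simp at hτ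
  have hMd : Nat.Coprime M (m + 1) := by
    rcases Nat.eq_zero_or_pos m with rfl | hm
    · simp
    · exact Nat.Coprime.coprime_dvd_right ⟨2, by ring⟩ (hgcd hm)
  refine ⟨fun j k j' k' hj hk => ?_, ?_⟩
  · rw [shiftedPhiTilde_eq hM m s j k t hτ hz₁ hz₂, shiftedPhiTilde_eq hM m s j' k' t hτ hz₁ hz₂,
      shiftedLattice_congr hM _ hτ z₁ z₂ hj hk, shiftedLattice_congr hM _ hτ z₂ z₁ hk hj]
  · have hinv : ∀ {z : ℂ}, (∀ a b : ℤ, z ≠ a + b * τ) →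
        ∀ a b : ℤ, z / τ ≠ a + b * (-M / τ) := fun {z} hz a b h =>
      hz (-(b * M)) a (by
        rw [div_eq_iff hτ0, add_mul, mul_assoc, div_mul_cancel₀ _ hτ0] at h
        push_cast; linear_combination h)
    rw [PhiTilde_eq m s _ (neg_natCast_div_im_pos hM hτ) (hinv hz₁) (hinv hz₂),
      latticeAppell_inversion hM _ hτ, latticeAppell_inversion hM _ hτ]
    simp only [shiftedPhiTilde_eq hM m s _ _ t hτ hz₁ hz₂]
    simp only [← Finset.mul_sum, Finset.sum_add_distrib]
    rw [Finset.sum_comm (f := fun j k : ℕ => shiftedLattice M (m + 1) k j τ z₂ z₁),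
      sum_shiftedLattice hM (Nat.succ_pos m) hMd hτ, sum_shiftedLattice hM (Nat.succ_pos m) hMd hτ,
      show ((m + 1 : ℕ) : ℂ) * z₂ * z₁ / (M * τ) = ((m + 1 : ℕ) : ℂ) * z₁ * z₂ / (M * τ) by ring]
    have he : e ((m + 1) * (t - z₁ * z₂ / (τ * M))) * e (((m + 1 : ℕ) : ℂ) * z₁ * z₂ / (M * τ))
        = e ((m + 1) * t) := by
      rw [← e_add]; congr 1; push_cast; field_simp; ring
    rw [← he]
    field_simp
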